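/- Let $K$ be a real closed field with a non-archimedean absolute value $|\cdot|_K\colon K\to\mathbb{R}_{\ge 0}$ (possibly trivial) that is compatible with the order of $K$: $0\le a\le b$ implies $|a|_K\le |b|_K$. Let $X$ be a variety over $K$, that is, a reduced, irreducible, separated scheme of finite type over $K$; for $p\in X$ let $K(p)$ be the residue field of $p$. The Berkovich analytification $X^{\mathrm{an}}$ is the set of pairs $(p,|\cdot|)$ with $p\in X$ and $|\cdot|$ a non-archimedean absolute value on $K(p)$ extending $|\cdot|_K$. The real analytification $X_r^{\mathrm{an}}$ is the set of triples $(p,|\cdot|,<)$ with $(p,|\cdot|)\in X^{\mathrm{an}}$ and $<$ an ordering of the field $K(p)$ compatible with $|\cdot|$ (that is, $0\le a\le b$ implies $|a|\le|b|$). It carries the coarsest topology such that the support map $\operatorname{supp}\colon X_r^{\mathrm{an}}\to X$, $x=(p_x,|\cdot|_x,<_x)\mapsto p_x$, is continuous and, for every open $U\subset X$ and every regular function $f$ on $U$, the map $\operatorname{supp}^{-1}(U)\to\mathbb{R}$, $x\mapsto \operatorname{sgn}_x(f)\,|f|_x$, is continuous. Here $\operatorname{sgn}_x(f)$ and $|f|_x$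 are the sign and the absolute value of the image of $f$ in $K(p_x)$. Likewise, $X^{\mathrm{an}}$ carries the coarsest topology such that the map $x=(p_x,|\cdot|_x)\mapsto p_x$ to $X$ is continuous and every map $x\mapsto|f|_x$ is continuous on the preimage of the domain $U$ of $f$. Let $\varphi\colon X_r^{\mathrm{an}}\to X^{\mathrm{an}}$, $(p,|\cdot|,<)\mapsto(p,|\cdot|)$. For a commutative ring $A$, let $\operatorname{Sper}(A)$ be the real spectrum of $A$: the set of orderings of $A$, that is, of subsets $P\subset A$ with $P+P\subset P$, $P\cdot P\subset P$, $P\cup -P=A$ and $P\cap -P$ a prime ideal, with the topology generated by the sets $\{P : -f\notin P\}$, $f\in A$. **Proposition.** Let $x=(p_x,|\cdot|_x)\in X^{\mathrm{an}}$. Let $\Gamma_x=|K(p_x)^*|_x$ be the value group of $|\cdot|_x$ (a multiplicative subgroup of $\mathbb{R}_{>0}$), let $2\Gamma_x$ denote the subgroup of squares in $\Gamma_x$, and let $k(x)$ be the residue field of the valuation ring $\{a\in K(p_x): |a|_x\le 1\}$. Then the fiber $\varphi^{-1}(x)$, with the subspace topology from $X_r^{\mathrm{an}}$, is homeomorphic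 to $D\times\operatorname{Sper} k(x)$, where $D$ is a discrete topological space of cardinality $|\Gamma_x/2\Gamma_x|$. -/

import Mathlib

universe u

noncomputable section

namespace RealAn

open AlgebraicGeometry CategoryTheory

section RealSpectrum

/-- The real spectrum of a commutative ring: the set of its orderings. -/
def Sper (A : Type u) [CommRing A] : Type u :=
  {P : RingPreordering A // P.IsOrdering}

variable {A : Type u} [CommRing A]

/-- `f ≥ 0` with respect to the ordering `P`, that is, `f ∈ P`. -/
def Sper.Nonneg (P : Sper A) (f : A) : Prop := f ∈ P.1

/-- `f > 0` with respect to the ordering `P`, that is, `-f ∉ P`. -/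
def Sper.Pos (P : Sper A) (f : A) : Prop := -f ∉ P.1

open Classical in
/-- The sign of `f` with respect to `P`: it is `1` if `f > 0`, it is `-1` if `-f > 0`,
and it is `0` if `f` lies in the support of `P`. -/
def Sper.sgn (P : Sper A) (f : A) : ℝ :=
  if P.Pos f then 1 else if P.Pos (-f) then -1 else 0

/-- The Harrison topology. -/
instance (A : Type u) [CommRing A] : TopologicalSpace (Sper A) :=
  TopologicalSpace.generateFrom {s | ∃ f : A, s = {P : Sper A | P.Pos f}}

end RealSpectrum

section ValuedField

variable {L : Type u} [Field L]

/-- An ordering `P` of `L` is compatible with an absolute value on `L` if `0 ≤ a ≤ b` with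
respect to `P` implies `|a| ≤ |b|`. -/
def Sper.Compatible (P : Sper L) (w : AbsoluteValue L ℝ) : Prop :=
  ∀ a b : L, P.Nonneg a → P.Nonneg (b - a) → w a ≤ w b

/-- The valuation ring `{a | |a| ≤ 1}` of a non-archimedean absolute value. -/
def valuationRing (w : AbsoluteValue L ℝ) (hw : IsNonarchimedean w) : ValuationSubring L where
  carrier := {a | w a ≤ 1}
  mul_mem' {a b} ha hb := by
    simp only [Set.mem_ofPred_eq, map_mul] at *
    exact mul_le_one₀ ha (w.nonneg b) hb
  one_mem' := by simp
  add_mem' {a b} ha hb := (hw a b).trans (max_le ha hb)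
  zero_mem' := by simp
  neg_mem' {a} ha := by simpa using ha
  mem_or_inv_mem' a := by
    simp only [Set.mem_ofPred_eq, map_inv₀]
    rcases le_total (w a) 1 with h | h
    · exact Or.inl h
    · exact Or.inr (inv_le_one_of_one_le₀ h)

/-- The residue field of the valuation ring of a non-archimedean absolute value. -/
abbrev residueFieldOf (w : AbsoluteValue L ℝ) (hw : IsNonarchimedean w) : Type u :=
  IsLocalRing.ResidueField (valuationRing w hw)

/-- The value group `Γ = |Lˣ|`, a multiplicative group of (positive) real numbers. -/
def valueGroup (w : AbsoluteValue L ℝ) : Subgroup ℝˣ :=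
  (Units.map (w : L →* ℝ)).range

/-- The quotient `Γ / 2Γ`. Since `Γ` is written multiplicatively, `2Γ` is the group of squares
of elements of `Γ`. -/
abbrev valueGroupModTwo (w : AbsoluteValue L ℝ) : Type :=
  valueGroup w ⧸ (powMonoidHom 2 : valueGroup w →* valueGroup w).range

end ValuedField

section Analytification

variable {K : Type u} [Field K] {X : Scheme.{u}}

/-- The structure map `K → K(p)` into the residue field at a point `p` of a `K`-scheme. -/
def scalarMap (f : X ⟶ Spec (CommRingCat.of K)) (p : X) : K →+* X.residueField p :=
  (Spec.preimage (X.fromSpecResidueField p ≫ f)).hom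

/-- The points of the Berkovich analytification `X^an` of a `K`-scheme `X`: pairs of a scheme
point `p` and a non-archimedean absolute value on `K(p)` that extends the one on `K`. -/
structure Analytification (v : AbsoluteValue K ℝ) (f : X ⟶ Spec (CommRingCat.of K)) where
  pt : X
  absVal : AbsoluteValue (X.residueField pt) ℝ
  isNonarchimedean : IsNonarchimedean absVal
  absVal_scalarMap : ∀ a : K, absVal (scalarMap f pt a) = v a

/-- The points of the real analytification `X_r^an`: triples of a scheme point `p`, a
non-archimedean absolute value on `K(p)` that extends the one on `K`, and an ordering of `K(p)`
that is compatible with this absolute value. -/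
structure RealAnalytification (v : AbsoluteValue K ℝ) (f : X ⟶ Spec (CommRingCat.of K)) extends
    Analytification v f where
  order : Sper (X.residueField pt)
  compatible : order.Compatible absVal

variable {v : AbsoluteValue K ℝ} {f : X ⟶ Spec (CommRingCat.of K)}

/-- `|s|_x` for a regular function `s` on an open set that contains the support of `x`. -/
def Analytification.value (x : Analytification v f) {U : X.Opens} (hx : x.pt ∈ U)
    (s : Γ(X, U)) : ℝ :=
  x.absVal (X.evaluation U x.pt hx s)

/-- `sgn_x(s) * |s|_x` for a regular function `s` on an open set that contains the support
of `x`. -/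
def RealAnalytification.signedValue (x : RealAnalytification v f) {U : X.Opens} (hx : x.pt ∈ U)
    (s : Γ(X, U)) : ℝ :=
  x.order.sgn (X.evaluation U x.pt hx s) * x.absVal (X.evaluation U x.pt hx s)

/-- The coarsest topology on `X^an` such that the support map is continuous and `x ↦ |s|_x` is
continuous on `supp⁻¹(U)` for all open `U` and all regular functions `s` on `U`. This is the
topology glued from the Berkovich spectra of the open affine subschemes of `X`. -/
instance : TopologicalSpace (Analytification v f) :=
  TopologicalSpace.generateFrom
    ({W | ∃ U : X.Opens, W = {x | x.pt ∈ U}} ∪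
     {W | ∃ (U : X.Opens) (s : Γ(X, U)) (V : Set ℝ), IsOpen V ∧
        W = {x | ∃ hx : x.pt ∈ U, x.value hx s ∈ V}})

/-- The coarsest topology on `X_r^an` such that the support map is continuous and
`x ↦ sgn_x(s) * |s|_x` is continuous on `supp⁻¹(U)` for all open `U` and all regular functions
`s` on `U`. -/
instance : TopologicalSpace (RealAnalytification v f) :=
  TopologicalSpace.generateFrom
    ({W | ∃ U : X.Opens, W = {x | x.pt ∈ U}} ∪
     {W | ∃ (U : X.Opens) (s : Γ(X, U)) (V : Set ℝ), IsOpen V ∧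
        W = {x | ∃ hx : x.pt ∈ U, x.signedValue hx s ∈ V}})

/-- The canonical map `φ : X_r^an → X^an` that forgets the ordering. -/
def forgetOrder (x : RealAnalytification v f) : Analytification v f := x.toAnalytification

end Analytification

end RealAn

end

/-!
The fiber over `x` is the space of orderings of `K(p)` that are compatible with `|·|`, that is,
those in which `1 + m` is positive for all `m` in the maximal ideal of the valuation ring. By Baer
and Krull, such an ordering amounts to the signs of lifts of an `𝔽₂`-basis of `Γ/2Γ` together with
the ordering it induces on the residue field: since squares are positive, the signs of these lifts
and of the units determine all signs, and they can be prescribed freely because units form a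
subgroup of `K(p)ˣ` with torsion-free quotient. The space of sign vectors is discrete because the
basis is finite: every element of `K` is a square up to sign, so distinct monomials in elements of
`K(p)ˣ` whose values are independent modulo squares have values in distinct classes modulo `|Kˣ|`.
Such elements are therefore algebraically independent over `K`, and the transcendence degree of
`K(p)` over `K` is finite.
-/

noncomputable section

namespace RealAn

open AlgebraicGeometry CategoryTheory

section SquareClasses

variable {G : Type*} [CommGroup G]

/-- The group `G / G²` of square classes of a commutative group, written additively so that it
is a vector space over `ZMod 2`. -/
abbrev SquareClasses (G : Type*) [CommGroup G] : Type _ :=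
  Additive (G ⧸ (powMonoidHom 2 : G →* G).range)

instance : Module (ZMod 2) (SquareClasses G) :=
  AddCommGroup.zmodModule fun x => by
    obtain ⟨g, rfl⟩ := QuotientGroup.mk'_surjective _ x.toMul
    exact (QuotientGroup.eq_one_iff (g ^ 2)).2 ⟨g, rfl⟩

namespace SquareClasses

/-- The projection of a commutative group onto its square classes. -/
def mk : Additive G →+ SquareClasses G :=
  MonoidHom.toAdditive (QuotientGroup.mk' _)

lemma mk_surjective : Function.Surjective (mk : Additive G →+ SquareClasses G) :=
  fun x => QuotientGroup.mk'_surjective _ x.toMul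

lemma mk_eq_zero_iff {g : G} : mk (.ofMul g) = 0 ↔ ∃ c, c ^ 2 = g :=
  QuotientGroup.eq_one_iff g

/-- A homomorphism into a vector space over `ZMod 2` factors through the square classes. -/
def lift {V : Type*} [AddCommGroup V] [Module (ZMod 2) V] (q : Additive G →+ V) :
    SquareClasses G →ₗ[ZMod 2] V :=
  AddMonoidHom.toZModLinearMap 2 <| MonoidHom.toAdditiveLeft <|
    QuotientGroup.lift _ (AddMonoidHom.toMultiplicativeRight q) <| by
      rintro _ ⟨g, rfl⟩
      change q (2 • Additive.ofMul g) = 0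
      rw [map_nsmul, ZModModule.char_nsmul_eq_zero]

/-- The bijection between square classes that is induced by an isomorphism of groups. -/
def congr {G' : Type*} [CommGroup G'] (e : G ≃* G') : SquareClasses G ≃ SquareClasses G' :=
  (QuotientGroup.congr _ _ e (by
    ext γ
    simp [Subgroup.mem_map, e.surjective.exists])).toEquiv

end SquareClasses

variable {H : Subgroup G} {ι : Type*} {a : ι → G}
  {b : Module.Basis ι (ZMod 2) (SquareClasses (G ⧸ H))}

variable (b) in
lemma exists_mk_eq_basis :
    ∃ a : ι → G, ∀ i, SquareClasses.mk (.ofMul (a i : G ⧸ H)) = b i := by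
  choose a ha using fun i =>
    (SquareClasses.mk_surjective.comp (QuotientGroup.mk'_surjective H)) (b i)
  exact ⟨a, ha⟩

lemma subgroup_eq_top_of_basis
    (hab : ∀ i, SquareClasses.mk (.ofMul (a i : G ⧸ H)) = b i) {S : Subgroup G} (hHS : H ≤ S)
    (haS : ∀ i, a i ∈ S) (hsq : ∀ c, c ^ 2 ∈ S) : S = ⊤ := by
  let q : Additive G →+ SquareClasses (G ⧸ H) :=
    SquareClasses.mk.comp (MonoidHom.toAdditive (QuotientGroup.mk' H))
  have hq : (AddSubgroup.toZModSubmodule 2 (S.toAddSubgroup.map q)) = ⊤ := by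
    rw [← top_le_iff, ← b.span_eq, Submodule.span_le]
    rintro _ ⟨i, rfl⟩
    exact ⟨.ofMul (a i), haS i, hab i⟩
  refine (Subgroup.eq_top_iff' S).2 fun g => ?_
  obtain ⟨s, hs, hsg⟩ : q (.ofMul g) ∈ S.toAddSubgroup.map q :=
    hq.ge (Submodule.mem_top (x := q (.ofMul g)))
  have hzero : SquareClasses.mk (.ofMul ((g / s.toMul : G) : G ⧸ H)) = 0 :=
    (map_sub q (.ofMul g) s).trans (sub_eq_zero.2 hsg.symm)
  obtain ⟨c, hc⟩ := SquareClasses.mk_eq_zero_iff.1 hzero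
  obtain ⟨c, rfl⟩ := QuotientGroup.mk_surjective c
  have hH : (c ^ 2)⁻¹ * (g / s.toMul) ∈ H := QuotientGroup.eq.1 hc
  have : g = c ^ 2 * ((c ^ 2)⁻¹ * (g / s.toMul)) * s.toMul := by simp
  exact this ▸ mul_mem (mul_mem (hsq c) (hHS hH)) hs

lemma continuous_monoidHom_apply_of_basis {Y : Type*} [TopologicalSpace Y] {χ : Y → G →* ℤˣ}
    (hab : ∀ i, SquareClasses.mk (.ofMul (a i : G ⧸ H)) = b i)
    (hH : ∀ h ∈ H, Continuous fun y => χ y h) (ha : ∀ i, Continuous fun y => χ y (a i)) (g : G) :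
    Continuous fun y => χ y g := by
  let S : Subgroup G :=
    { carrier := {g | Continuous fun y => χ y g}
      one_mem' := by
        simp only [Set.mem_ofPred_eq, map_one, continuous_const]
      mul_mem' := fun hg hh => by
        simp only [Set.mem_ofPred_eq, map_mul]
        exact hg.mul hh
      inv_mem' := fun hg => by
        simp only [Set.mem_ofPred_eq, map_inv]
        exact hg.inv }
  suffices S = ⊤ from this.ge (Subgroup.mem_top g)
  refine subgroup_eq_top_of_basis hab hH ha fun c => ?_
  change Continuous fun y => χ y (c ^ 2)
  simpa only [map_pow, Int.units_sq] using continuous_const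

lemma monoidHom_ext_of_basis {χ χ' : G →* ℤˣ}
    (hab : ∀ i, SquareClasses.mk (.ofMul (a i : G ⧸ H)) = b i)
    (hH : ∀ h ∈ H, χ h = χ' h) (ha : ∀ i, χ (a i) = χ' (a i)) : χ = χ' := by
  suffices χ.eqLocus χ' = ⊤ from MonoidHom.eq_of_eqOn_top fun g _ => this.ge (Subgroup.mem_top g)
  refine subgroup_eq_top_of_basis hab hH ha fun c => ?_
  change χ (c ^ 2) = χ' (c ^ 2)
  rw [map_pow, map_pow, Int.units_sq, Int.units_sq]

lemma exists_monoidHom_comp_subtype_eq (hH : ∀ c : G, c ^ 2 ∈ H → c ∈ H) (ψ : H →* ℤˣ) :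
    ∃ χ : G →* ℤˣ, χ.comp H.subtype = ψ := by
  let incl : SquareClasses H →ₗ[ZMod 2] SquareClasses G :=
    SquareClasses.lift (SquareClasses.mk.comp (MonoidHom.toAdditive H.subtype))
  have hincl : LinearMap.ker incl = ⊥ := by
    refine LinearMap.ker_eq_bot'.2 fun x hx => ?_
    obtain ⟨h, rfl⟩ := SquareClasses.mk_surjective x
    obtain ⟨c, hc⟩ := SquareClasses.mk_eq_zero_iff.1 hx
    exact SquareClasses.mk_eq_zero_iff.2 ⟨⟨c, hH c (hc ▸ h.toMul.2)⟩, Subtype.ext hc⟩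
  obtain ⟨r, hr⟩ := LinearMap.exists_leftInverse_of_injective incl hincl
  let ψ' := SquareClasses.lift (MonoidHom.toAdditive ψ)
  refine ⟨MonoidHom.toAdditive.symm ((ψ' ∘ₗ r).toAddMonoidHom.comp SquareClasses.mk), ?_⟩
  ext1 h
  exact congrArg (Additive.toMul ∘ ψ') (LinearMap.congr_fun hr (SquareClasses.mk (.ofMul h)))

lemma exists_monoidHom_extending (hH : ∀ c : G, c ^ 2 ∈ H → c ∈ H)
    (hab : ∀ i, SquareClasses.mk (.ofMul (a i : G ⧸ H)) = b i) (ε : ι → ℤˣ) (ψ : H →* ℤˣ) :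
    ∃ χ : G →* ℤˣ, (∀ i, χ (a i) = ε i) ∧ χ.comp H.subtype = ψ := by
  obtain ⟨χ, hχ⟩ := exists_monoidHom_comp_subtype_eq hH ψ
  let δ : SquareClasses (G ⧸ H) →ₗ[ZMod 2] Additive ℤˣ :=
    b.constr (ZMod 2) fun i => .ofMul (ε i / χ (a i))
  let η : G →* ℤˣ := (MonoidHom.toAdditive.symm (δ.toAddMonoidHom.comp SquareClasses.mk)).comp
    (QuotientGroup.mk' H)
  have hη (i : ι) : η (a i) = ε i / χ (a i) :=
    congrArg Additive.toMul ((congrArg δ (hab i)).trans (b.constr_basis (ZMod 2) _ i))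
  have hηH (h : H) : η h = 1 := by
    simp only [η, MonoidHom.comp_apply, QuotientGroup.mk'_apply,
      (QuotientGroup.eq_one_iff (h : G)).2 h.2, map_one]
  refine ⟨χ * η, fun i => by simp [hη], ?_⟩
  rw [← hχ]
  ext1 h
  simp [hηH]

end SquareClasses

section Independence

lemma linearIndependent_int_of_zmod {n : ℕ} (hn : 1 < n) {M V ι : Type*} [AddCommGroup M]
    [AddCommGroup V] [Module (ZMod n) V] (hM : ∀ x : M, n • x = 0 → x = 0) (q : M →+ V)
    {x : ι → M} (hx : LinearIndependent (ZMod n) (q ∘ x)) : LinearIndependent ℤ x := by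
  have descent (m : ι →₀ ℤ) (hm : Finsupp.linearCombination ℤ x m = 0) :
      ∃ m' : ι →₀ ℤ, m = n • m' ∧ Finsupp.linearCombination ℤ x m' = 0 := by
    have hmod : m.mapRange (Int.castAddHom (ZMod n)) (map_zero _) = 0 := by
      refine linearIndependent_iff.1 hx _ ?_
      simpa [Finsupp.linearCombination_apply, Finsupp.sum_mapRange_index, Int.cast_smul_eq_zsmul,
        map_finsuppSum] using congrArg q hm
    have hdvd (i : ι) : (n : ℤ) ∣ m i :=
      (ZMod.intCast_zmod_eq_zero_iff_dvd _ n).1 (by simpa using DFunLike.congr_fun hmod i)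
    have hdiv : m = n • m.mapRange (· / (n : ℤ)) (Int.zero_ediv _) := by
      ext i
      simp [Int.mul_ediv_cancel' (hdvd i)]
    refine ⟨_, hdiv, hM _ ?_⟩
    rwa [← map_nsmul, ← hdiv]
  have pow_dvd (k : ℕ) : ∀ m : ι →₀ ℤ, Finsupp.linearCombination ℤ x m = 0 →
      ∀ i, (n : ℤ) ^ k ∣ m i := by
    induction k with
    | zero => simp
    | succ k ih =>
      intro m hm i
      obtain ⟨m', rfl, hm'⟩ := descent m hm
      simpa [pow_succ'] using mul_dvd_mul_left (n : ℤ) (ih m' hm' i)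
  refine linearIndependent_iff.2 fun m hm => Finsupp.ext fun i => ?_
  refine Int.eq_zero_of_abs_lt_dvd (pow_dvd (m i).natAbs m hm i) ?_
  rw [Int.abs_eq_natAbs]
  exact_mod_cast Nat.lt_pow_self hn

lemma linearIndependent_int_quotient {G ι : Type*} [CommGroup G] {H N : Subgroup G}
    (hH : ∀ c : G, c ^ 2 ∈ H → c ∈ H) (hHN : H ≤ N) (hN : ∀ g ∈ N, ∃ c ∈ N, g / c ^ 2 ∈ H)
    {a : ι → G}
    (ha : LinearIndependent (ZMod 2) fun i => SquareClasses.mk (.ofMul (a i : G ⧸ H))) :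
    LinearIndependent ℤ fun i => Additive.ofMul (a i : G ⧸ N) := by
  have torsionFree (x : Additive (G ⧸ N)) (hx : 2 • x = 0) : x = 0 := by
    obtain ⟨g, rfl⟩ := QuotientGroup.mk'_surjective _ x.toMul
    obtain ⟨c, hc, hgc⟩ := hN _ ((QuotientGroup.eq_one_iff (g ^ 2)).1 hx)
    have hgc' : g / c ∈ N := hHN (hH _ (by rwa [div_pow]))
    exact (QuotientGroup.eq_one_iff g).2 (by simpa using mul_mem hgc' hc)
  let q : Additive (G ⧸ N) →+ SquareClasses (G ⧸ H) := MonoidHom.toAdditive <|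
    QuotientGroup.lift N ((QuotientGroup.mk' _).comp (QuotientGroup.mk' H)) fun g hg => by
      obtain ⟨c, -, hgc⟩ := hN g hg
      exact SquareClasses.mk_eq_zero_iff.2 ⟨c, (QuotientGroup.eq_iff_div_mem.2 hgc).symm⟩
  exact linearIndependent_int_of_zmod one_lt_two torsionFree q ha

lemma eq_of_prod_pow_div_mem {G ι : Type*} [CommGroup G] {N : Subgroup G} {a : ι → G}
    (ha : LinearIndependent ℤ fun i => Additive.ofMul (a i : G ⧸ N)) {d e : ι →₀ ℕ}
    (h : (d.prod fun i n => a i ^ n) / (e.prod fun i n => a i ^ n) ∈ N) : d = e := by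
  have linearCombination_eq (d : ι →₀ ℕ) :
      Finsupp.linearCombination ℕ (fun i => Additive.ofMul (a i : G ⧸ N)) d =
        .ofMul ((d.prod fun i n => a i ^ n : G) : G ⧸ N) := by
    simp [Finsupp.linearCombination_apply, Finsupp.sum, Finsupp.prod, QuotientGroup.mk_prod]
  have hnat : LinearIndependent ℕ fun i => Additive.ofMul (a i : G ⧸ N) :=
    ha.restrict_scalars fun m n hmn => by simpa using hmn
  refine hnat ?_
  rw [linearCombination_eq, linearCombination_eq, QuotientGroup.eq_iff_div_mem.2 h]

variable {L : Type*} [Field L]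

lemma exists_valuation_eq_of_sum_eq_zero (A : ValuationSubring L) {ι : Type*} {s : Finset ι}
    (hs : s.Nonempty) {l : ι → Lˣ} (h : ∑ i ∈ s, (l i : L) = 0) :
    ∃ i ∈ s, ∃ j ∈ s, i ≠ j ∧ A.valuation (l i) = A.valuation (l j) := by
  classical
  obtain ⟨k, hk, hmax⟩ := s.exists_max_image (fun i => A.valuation (l i)) hs
  by_contra! hne
  have hsum := A.valuation.map_sum_eq_of_lt (f := fun i => (l i : L)) hk
    fun j hj => by
      rw [Finset.mem_sdiff, Finset.mem_singleton] at hj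
      exact (hmax j hj.1).lt_of_ne (hne j hj.1 k hk hj.2)
  rw [h, map_zero] at hsum
  exact (l k).ne_zero (A.valuation.zero_iff.1 hsum.symm)

lemma algebraicIndependent_of_monomials_injective_mod {K ι : Type*} [Field K] [Algebra K L]
    (A : ValuationSubring L) {N : Subgroup Lˣ} (hA : A.unitGroup ≤ N)
    (hK : (Units.map (algebraMap K L : K →* L)).range ≤ N) {a : ι → Lˣ}
    (ha : ∀ d e : ι →₀ ℕ,
      (d.prod fun i n => a i ^ n) / (e.prod fun i n => a i ^ n) ∈ N → d = e) :
    AlgebraicIndependent K fun i => (a i : L) := by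
  refine algebraicIndependent_iff.2 fun p hp => by_contra fun hp0 => ?_
  have coeff_ne_zero (d : p.support) : p.coeff d ≠ 0 := MvPolynomial.mem_support_iff.1 d.2
  let c (d : p.support) : Lˣ := Units.map (algebraMap K L : K →* L) (Units.mk0 _ (coeff_ne_zero d))
  have hc (d : p.support) : c d ∈ N := hK ⟨_, rfl⟩
  let monomial (d : ι →₀ ℕ) : Lˣ := d.prod fun i n => a i ^ n
  have hsum : ∑ d : p.support, ((c d * monomial d : Lˣ) : L) = 0 := by
    rw [MvPolynomial.aeval_def, MvPolynomial.eval₂_eq, ← Finset.sum_coe_sort] at hp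
    simpa [c, monomial, Finsupp.prod] using hp
  obtain ⟨d, -, e, -, hde, hval⟩ := exists_valuation_eq_of_sum_eq_zero A
    (Finset.univ_nonempty_iff.2 (MvPolynomial.support_nonempty.2 hp0).to_subtype) hsum
  have hdiv : c d * monomial d / (c e * monomial e) ∈ A.unitGroup := by
    rw [ValuationSubring.mem_unitGroup_iff, Units.val_div_eq_div_val, map_div₀, hval,
      div_self ((Valuation.ne_zero_iff _).2 (Units.ne_zero _))]
  refine hde (Subtype.ext (ha d e ?_))
  rw [mul_div_mul_comm] at hdiv
  exact (N.mul_mem_cancel_left (div_mem (hc d) (hc e))).1 (hA hdiv)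

lemma mem_unitGroup_of_sq_mem (A : ValuationSubring L) (c : Lˣ) (hc : c ^ 2 ∈ A.unitGroup) :
    c ∈ A.unitGroup := by
  rw [ValuationSubring.mem_unitGroup_iff, Units.val_pow_eq_pow_val, map_pow] at hc
  rw [ValuationSubring.mem_unitGroup_iff]
  exact (pow_eq_one_iff_of_nonneg zero_le two_ne_zero).1 hc

lemma exists_sq_or_neg_sq {K : Type*} [Field K] (hK : ∀ c : K, IsSquare c ∨ IsSquare (-c))
    (c : Kˣ) : ∃ d : Kˣ, c = d ^ 2 ∨ c = -d ^ 2 := by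
  have units_sq {x : Kˣ} (hx : IsSquare (x : K)) : ∃ d : Kˣ, x = d ^ 2 := by
    obtain ⟨d, hd⟩ := hx
    exact ⟨Units.mk0 d (by rintro rfl; simp at hd), Units.ext (by simpa [sq] using hd)⟩
  rcases hK c with h | h
  · exact (units_sq h).imp fun d => .inl
  · exact (units_sq (x := -c) h).imp fun d hd => .inr (neg_eq_iff_eq_neg.1 hd)

lemma finite_squareClasses_quotient_unitGroup {K : Type*} [Field K] [Algebra K L] [FinTrdeg K L]
    (hK : ∀ c : K, IsSquare c ∨ IsSquare (-c)) (A : ValuationSubring L) :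
    Finite (SquareClasses (Lˣ ⧸ A.unitGroup)) := by
  let b := Module.Basis.ofVectorSpace (ZMod 2) (SquareClasses (Lˣ ⧸ A.unitGroup))
  obtain ⟨a, hab⟩ := exists_mk_eq_basis b
  let φ : Kˣ →* Lˣ := Units.map (algebraMap K L : K →* L)
  have hN (g : Lˣ) (hg : g ∈ A.unitGroup ⊔ φ.range) :
      ∃ c ∈ A.unitGroup ⊔ φ.range, g / c ^ 2 ∈ A.unitGroup := by
    obtain ⟨u, hu, _, ⟨c, rfl⟩, rfl⟩ := Subgroup.mem_sup.1 hg
    obtain ⟨d, rfl | rfl⟩ := exists_sq_or_neg_sq hK c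
    · exact ⟨φ d, Subgroup.mem_sup_right ⟨d, rfl⟩, by simpa using hu⟩
    · refine ⟨φ d, Subgroup.mem_sup_right ⟨d, rfl⟩, ?_⟩
      simpa [φ, ValuationSubring.mem_unitGroup_iff, Units.map_neg] using hu
  have hindep : LinearIndependent (ZMod 2) fun i =>
      SquareClasses.mk (.ofMul (a i : Lˣ ⧸ A.unitGroup)) := by
    simpa only [hab] using b.linearIndependent
  have hmonomials (d e) := eq_of_prod_pow_div_mem (d := d) (e := e)
    (linearIndependent_int_quotient (mem_unitGroup_of_sq_mem A) le_sup_left hN hindep)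
  have halg := algebraicIndependent_of_monomials_injective_mod A le_sup_left le_sup_right hmonomials
  have := finite_of_algebraicIndependent halg
  have := Module.Finite.of_basis b
  exact Module.finite_of_finite (ZMod 2)

end Independence

section SignCharacter

lemma units_int_eq_iff {e e' : ℤˣ} : e = e' ↔ (e = 1 ↔ e' = 1) := by
  rcases Int.units_eq_one_or e with rfl | rfl <;>
    rcases Int.units_eq_one_or e' with rfl | rfl <;> decide

variable {F : Type*} [Field F]

namespace Sper

lemma Nonneg.add {P : Sper F} {a b : F} (ha : P.Nonneg a) (hb : P.Nonneg b) : P.Nonneg (a + b) :=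
  add_mem ha hb

lemma Nonneg.mul {P : Sper F} {a b : F} (ha : P.Nonneg a) (hb : P.Nonneg b) : P.Nonneg (a * b) :=
  mul_mem ha hb

lemma Nonneg.eq_zero {P : Sper F} {a : F} (ha : P.Nonneg a) (ha' : P.Nonneg (-a)) : a = 0 :=
  RingPreordering.eq_zero_of_mem_of_neg_mem ha ha'

lemma nonneg_one (P : Sper F) : P.Nonneg 1 :=
  one_mem P.1

lemma not_nonneg_neg_one (P : Sper F) : ¬ P.Nonneg (-1) :=
  P.1.neg_one_notMem

lemma nonneg_or_nonneg_neg (P : Sper F) (a : F) : P.Nonneg a ∨ P.Nonneg (-a) :=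
  P.2.toHasMemOrNegMem.mem_or_neg_mem a

lemma nonneg_neg_iff {P : Sper F} {a : F} (ha : a ≠ 0) : P.Nonneg (-a) ↔ ¬ P.Nonneg a :=
  ⟨fun h h' => ha (h'.eq_zero h),
    (P.nonneg_or_nonneg_neg a).resolve_left⟩

lemma pos_iff_nonneg {P : Sper F} {a : F} (ha : a ≠ 0) : P.Pos a ↔ P.Nonneg a :=
  (not_congr (nonneg_neg_iff ha)).trans not_not

lemma not_pos_zero (P : Sper F) : ¬ P.Pos 0 :=
  fun h => h (by simp)

lemma nonneg_mul_iff {P : Sper F} {a b : F} (ha : a ≠ 0) (hb : b ≠ 0) :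
    P.Nonneg (a * b) ↔ (P.Nonneg a ↔ P.Nonneg b) := by
  have hab := nonneg_neg_iff (P := P) (mul_ne_zero ha hb)
  rcases P.nonneg_or_nonneg_neg a with h | h <;> rcases P.nonneg_or_nonneg_neg b with h' | h'
  · exact iff_of_true (h.mul h') (iff_of_true h h')
  · exact iff_of_false (hab.1 (by simpa using h.mul h')) fun hiff =>
      (nonneg_neg_iff hb).1 h' (hiff.1 h)
  · exact iff_of_false (hab.1 (by simpa using h.mul h')) fun hiff =>
      (nonneg_neg_iff ha).1 h (hiff.2 h')
  · exact iff_of_true (by simpa using h.mul h') (iff_of_false ((nonneg_neg_iff ha).1 h)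
      ((nonneg_neg_iff hb).1 h'))

open Classical in
/-- The sign of nonzero elements with respect to an ordering of a field, as a character of the
multiplicative group. -/
def signHom (P : Sper F) : Fˣ →* ℤˣ where
  toFun a := if P.Nonneg (a : F) then 1 else -1
  map_one' := if_pos P.nonneg_one
  map_mul' a b := by
    simp only [Units.val_mul, nonneg_mul_iff a.ne_zero b.ne_zero]
    by_cases ha : P.Nonneg (a : F) <;> by_cases hb : P.Nonneg (b : F) <;> simp [ha, hb]

lemma signHom_eq_one_iff {P : Sper F} {a : Fˣ} : P.signHom a = 1 ↔ P.Nonneg (a : F) := by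
  classical
  change (if P.Nonneg (a : F) then (1 : ℤˣ) else -1) = 1 ↔ _
  split_ifs with h <;> simp [h]

lemma signHom_neg (P : Sper F) (a : Fˣ) : P.signHom (-a) = -P.signHom a := by
  have neg_one : P.signHom (-1) = -1 := (Int.units_eq_one_or _).resolve_left fun h =>
    P.not_nonneg_neg_one (by simpa using signHom_eq_one_iff.1 h)
  rw [← neg_one_mul, map_mul, neg_one, neg_one_mul]

lemma signHom_eq_signHom_iff {E : Type*} [Field E] {P : Sper F} {Q : Sper E} {a : Fˣ} {b : Eˣ} :
    P.signHom a = Q.signHom b ↔ (P.Nonneg (a : F) ↔ Q.Nonneg (b : E)) := by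
  rw [units_int_eq_iff, signHom_eq_one_iff, signHom_eq_one_iff]

lemma signHom_injective : Function.Injective (signHom : Sper F → Fˣ →* ℤˣ) := by
  refine fun P Q h => Subtype.ext (SetLike.ext fun x => ?_)
  obtain rfl | hx := eq_or_ne x 0
  · simp
  · exact signHom_eq_signHom_iff.1 (DFunLike.congr_fun h (Units.mk0 x hx))

/-- The ordering of a field with a given set of nonnegative elements. -/
def ofNonneg (S : Set F) (add : ∀ {x y}, x ∈ S → y ∈ S → x + y ∈ S)
    (mul : ∀ {x y}, x ∈ S → y ∈ S → x * y ∈ S) (total : ∀ x, x ∈ S ∨ -x ∈ S)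
    (neg_one : -1 ∉ S) : Sper F :=
  let P : RingPreordering F := .mk' S add mul
    (fun x => (total x).elim (fun h => mul h h) fun h => by simpa using mul h h) neg_one
  have : HasMemOrNegMem P := ⟨total⟩
  ⟨P, { toHasMemOrNegMem := inferInstance, toIsPrime := inferInstance }⟩

@[simp]
lemma nonneg_ofNonneg {S : Set F} {add mul total neg_one} {x : F} :
    (ofNonneg S add mul total neg_one).Nonneg x ↔ x ∈ S :=
  Iff.rfl

lemma exists_signHom_eq {χ : Fˣ →* ℤˣ} (hneg : χ (-1) = -1)
    (hadd : ∀ a b : Fˣ, χ a = 1 → (b : F) = 1 + a → χ b = 1) : ∃ P : Sper F, P.signHom = χ := by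
  let S : Set F := {x | x = 0 ∨ ∃ a : Fˣ, χ a = 1 ∧ (a : F) = x}
  have coe_mem_iff (a : Fˣ) : (a : F) ∈ S ↔ χ a = 1 :=
    ⟨fun h => (h.resolve_left a.ne_zero).elim fun b hb => Units.ext hb.2 ▸ hb.1,
      fun h => .inr ⟨a, h, rfl⟩⟩
  have add {x y : F} (hx : x ∈ S) (hy : y ∈ S) : x + y ∈ S := by
    rcases hx with rfl | ⟨a, ha, rfl⟩
    · rwa [zero_add]
    rcases hy with rfl | ⟨b, hb, rfl⟩
    · rwa [add_zero, coe_mem_iff]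
    refine or_iff_not_imp_left.2 fun h => ⟨Units.mk0 _ h, ?_, rfl⟩
    have := hadd (b / a) (Units.mk0 _ h / a) (by rw [map_div, ha, hb, div_one])
      (by simp [add_div])
    rwa [map_div, ha, div_one] at this
  have mul {x y : F} (hx : x ∈ S) (hy : y ∈ S) : x * y ∈ S := by
    rcases hx with rfl | ⟨a, ha, rfl⟩
    · exact .inl (zero_mul y)
    rcases hy with rfl | ⟨b, hb, rfl⟩
    · exact .inl (mul_zero _)
    exact .inr ⟨a * b, by rw [map_mul, ha, hb, one_mul], Units.val_mul a b⟩
  have apply_neg (a : Fˣ) : χ (-a) = -χ a := by rw [← neg_one_mul, map_mul, hneg, neg_one_mul]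
  have total (x : F) : x ∈ S ∨ -x ∈ S := by
    obtain rfl | hx := eq_or_ne x 0
    · exact .inl (.inl rfl)
    lift x to Fˣ using hx.isUnit
    rw [← Units.val_neg, coe_mem_iff, coe_mem_iff, apply_neg, neg_eq_iff_eq_neg]
    exact Int.units_eq_one_or _
  have neg_one : (-1 : F) ∉ S := by
    rw [← Units.val_one, ← Units.val_neg, coe_mem_iff, hneg]
    decide
  refine ⟨ofNonneg S add mul total neg_one, MonoidHom.ext fun a => ?_⟩
  rw [units_int_eq_iff, signHom_eq_one_iff, nonneg_ofNonneg, coe_mem_iff]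

lemma isOpen_setOf_pos (a : F) : IsOpen {P : Sper F | P.Pos a} :=
  TopologicalSpace.isOpen_generateFrom_of_mem ⟨a, rfl⟩

lemma setOf_signHom_eq_one (a : Fˣ) :
    {P : Sper F | P.signHom a = 1} = {P : Sper F | P.Pos (a : F)} := by
  ext P
  exact signHom_eq_one_iff.trans (pos_iff_nonneg a.ne_zero).symm

lemma continuous_signHom_apply (a : Fˣ) : Continuous fun P : Sper F => P.signHom a := by
  refine continuous_discrete_rng.2 fun e => ?_
  rcases Int.units_eq_one_or e with rfl | rfl
  · rw [← Set.ofPred_eq_eq_singleton, Set.preimage_ofPred_eq, setOf_signHom_eq_one]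
    exact isOpen_setOf_pos _
  · convert isOpen_setOf_pos ((-a : Fˣ) : F)
    rw [← setOf_signHom_eq_one]
    ext P
    simp [signHom_neg, neg_eq_iff_eq_neg]

lemma continuous_iff_signHom {Y : Type*} [TopologicalSpace Y] {g : Y → Sper F} :
    Continuous g ↔ ∀ a, Continuous fun y => (g y).signHom a := by
  refine ⟨fun hg a => (continuous_signHom_apply a).comp hg, fun hg => ?_⟩
  refine continuous_generateFrom_iff.2 ?_
  rintro _ ⟨x, rfl⟩
  obtain rfl | hx := eq_or_ne x 0
  · simp [not_pos_zero]
  · rw [← Units.val_mk0 hx, ← setOf_signHom_eq_one]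
    exact (isOpen_discrete {1}).preimage (hg (Units.mk0 x hx))

end Sper

end SignCharacter

section BaerKrull

variable {L : Type*} [Field L] {A : ValuationSubring L}

namespace Sper

/-- An ordering of a field is compatible with a valuation ring if `1 + m` is nonnegative for
every `m` in the maximal ideal. This is equivalent to the convexity of the valuation ring. -/
def CompatibleRing (P : Sper L) (A : ValuationSubring L) : Prop :=
  ∀ m ∈ A.nonunits, P.Nonneg (1 + m)

lemma residue_eq_zero_of_residue_add_eq_zero {P : Sper L} (hP : P.CompatibleRing A) {a b : A}
    (ha : P.Nonneg (a : L)) (hb : P.Nonneg (b : L)) (hab : IsLocalRing.residue A (a + b) = 0) :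
    IsLocalRing.residue A a = 0 := by
  by_contra! h
  obtain ⟨u, rfl⟩ := (IsLocalRing.residue_ne_zero_iff_isUnit a).1 h
  have mem : (-(u⁻¹ * (u + b) : A) : L) ∈ A.nonunits := by
    refine neg_mem (A.coe_mem_nonunits_iff.2 ((IsLocalRing.residue_eq_zero_iff _).1 ?_))
    rw [map_mul, hab, mul_zero]
  have nonneg_neg : P.Nonneg (-b : L) := by
    have coe_mul_inv : ((u : A) : L) * ((u⁻¹ : Aˣ) : A) = 1 := by
      rw [← MulMemClass.coe_mul, u.mul_inv, OneMemClass.coe_one]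
    convert ha.mul (hP _ mem) using 1
    push_cast
    linear_combination (u + b : L) * coe_mul_inv
  have : b = 0 := Subtype.ext (hb.eq_zero nonneg_neg)
  rw [this, add_zero] at hab
  exact h hab

/-- The ordering of the residue field induced by an ordering that is compatible with a valuation
ring: its nonnegative elements are the residues of nonnegative elements. -/
def residueOrder {P : Sper L} (hP : P.CompatibleRing A) : Sper (IsLocalRing.ResidueField A) :=
  ofNonneg {q | ∃ a : A, P.Nonneg (a : L) ∧ IsLocalRing.residue A a = q}
    (by
      rintro _ _ ⟨a, ha, rfl⟩ ⟨b, hb, rfl⟩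
      exact ⟨a + b, ha.add hb, map_add _ a b⟩)
    (by
      rintro _ _ ⟨a, ha, rfl⟩ ⟨b, hb, rfl⟩
      exact ⟨a * b, ha.mul hb, map_mul _ a b⟩)
    (fun q => by
      obtain ⟨a, rfl⟩ := IsLocalRing.residue_surjective q
      exact (P.nonneg_or_nonneg_neg (a : L)).imp (fun h => ⟨a, h, rfl⟩)
        fun h => ⟨-a, h, map_neg _ a⟩)
    (by
      rintro ⟨a, ha, h⟩
      have : IsLocalRing.residue A 1 = 0 :=
        residue_eq_zero_of_residue_add_eq_zero hP P.nonneg_one ha (by simp [h])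
      simp at this)

lemma signHom_residueOrder {P : Sper L} (hP : P.CompatibleRing A) (u : A.unitGroup) :
    (residueOrder hP).signHom (A.unitGroupToResidueFieldUnits u) = P.signHom u := by
  refine signHom_eq_signHom_iff.2 ⟨?_, fun h => ⟨A.unitGroupMulEquiv u, h, rfl⟩⟩
  rintro ⟨a, ha, hau⟩
  refine (P.nonneg_or_nonneg_neg _).resolve_right fun hu => ?_
  replace hau : IsLocalRing.residue A a = IsLocalRing.residue A (A.unitGroupMulEquiv u) := hau
  have := residue_eq_zero_of_residue_add_eq_zero (a := -(A.unitGroupMulEquiv u : A)) hP hu ha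
    (by simp [hau])
  simp at this

section Lift

variable {χ : Lˣ →* ℤˣ} {Q : Sper (IsLocalRing.ResidueField A)}

lemma apply_eq_one_iff_nonneg_residue
    (hχ : χ.comp A.unitGroup.subtype = Q.signHom.comp A.unitGroupToResidueFieldUnits)
    {r : A} (hr : IsLocalRing.residue A r ≠ 0) {a : Lˣ} (ha : (a : L) = r) :
    χ a = 1 ↔ Q.Nonneg (IsLocalRing.residue A r) := by
  have mem : a ∈ A.unitGroup := by
    rw [A.mem_unitGroup_iff, ha, ← A.valuation_eq_one_iff]
    exact (IsLocalRing.residue_ne_zero_iff_isUnit r).1 hr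
  have hr' : A.unitGroupMulEquiv ⟨a, mem⟩ = r := Subtype.ext ha
  have := DFunLike.congr_fun hχ ⟨a, mem⟩
  simp only [MonoidHom.comp_apply, Subgroup.subtype_apply] at this
  rw [this, signHom_eq_one_iff, A.coe_unitGroupToResidueFieldUnits_apply, hr']
  rfl

lemma apply_eq_one_of_eq_one_add
    (hχ : χ.comp A.unitGroup.subtype = Q.signHom.comp A.unitGroupToResidueFieldUnits)
    {a b : Lˣ} (ha : χ a = 1) (hb : (b : L) = 1 + a) : χ b = 1 := by
  wlog haA : (a : L) ∈ A generalizing a b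
  · have := this (a := a⁻¹) (b := b / a) (by rw [map_inv, ha, inv_one])
      (by simp [hb, add_div, add_comm]) (by simpa using (A.mem_or_inv_mem _).resolve_left haA)
    rwa [map_div, ha, div_one] at this
  have hres : Q.Nonneg (IsLocalRing.residue A ⟨a, haA⟩) := by
    by_cases h : IsLocalRing.residue A ⟨a, haA⟩ = 0
    · exact h ▸ zero_mem Q.1
    · exact (apply_eq_one_iff_nonneg_residue hχ h rfl).1 ha
  have hres' : Q.Nonneg (IsLocalRing.residue A (1 + ⟨a, haA⟩)) := by
    rw [map_add, map_one]
    exact Q.nonneg_one.add hres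
  refine (apply_eq_one_iff_nonneg_residue hχ (fun h => ?_) hb).2 hres'
  rw [map_add, map_one, add_comm, add_eq_zero_iff_eq_neg] at h
  exact Q.not_nonneg_neg_one (h ▸ hres)

lemma exists_residueOrder_eq
    (hχ : χ.comp A.unitGroup.subtype = Q.signHom.comp A.unitGroupToResidueFieldUnits) :
    ∃ (P : Sper L) (hP : P.CompatibleRing A), P.signHom = χ ∧ residueOrder hP = Q := by
  have hneg : χ (-1) = -1 := (Int.units_eq_one_or _).resolve_left fun h => by
    have := (apply_eq_one_iff_nonneg_residue hχ (r := -1) (by simp) (by simp)).1 h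
    rw [map_neg, map_one] at this
    exact Q.not_nonneg_neg_one this
  obtain ⟨P, rfl⟩ := exists_signHom_eq hneg fun _ _ => apply_eq_one_of_eq_one_add hχ
  have hP : P.CompatibleRing A := fun m hm => by
    obtain ⟨hmA, hm⟩ := A.mem_nonunits_iff_exists_mem_maximalIdeal.1 hm
    have hres : IsLocalRing.residue A (1 + ⟨m, hmA⟩) = 1 := by
      rw [map_add, map_one, (IsLocalRing.residue_eq_zero_iff _).2 hm, add_zero]
    have hne : IsLocalRing.residue A (1 + ⟨m, hmA⟩) ≠ 0 := hres ▸ one_ne_zero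
    have hne' : 1 + m ≠ 0 := fun h =>
      hne ((congrArg _ (Subtype.ext h : (1 + ⟨m, hmA⟩ : A) = 0)).trans (map_zero _))
    refine signHom_eq_one_iff (a := Units.mk0 _ hne').1 ?_
    exact (apply_eq_one_iff_nonneg_residue hχ hne rfl).2 (hres ▸ Q.nonneg_one)
  refine ⟨P, hP, rfl, signHom_injective (MonoidHom.ext fun q => ?_)⟩
  obtain ⟨u, rfl⟩ := A.surjective_unitGroupToResidueFieldUnits q
  rw [signHom_residueOrder]
  exact DFunLike.congr_fun hχ u

end Lift

section Basis

variable {ι : Type*} {a : ι → Lˣ} {b : Module.Basis ι (ZMod 2) (SquareClasses (Lˣ ⧸ A.unitGroup))}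
  (hab : ∀ i, SquareClasses.mk (.ofMul (a i : Lˣ ⧸ A.unitGroup)) = b i)

/-- The Baer–Krull data of an ordering that is compatible with a valuation ring: the signs of the
elements of a given family, which is to represent a basis of the square classes of the value
group, and the induced ordering of the residue field. -/
def baerKrullMap (a : ι → Lˣ) (P : {P : Sper L // P.CompatibleRing A}) :
    (ι → ℤˣ) × Sper (IsLocalRing.ResidueField A) :=
  (fun i => P.1.signHom (a i), residueOrder P.2)

lemma continuous_baerKrullMap :
    Continuous (baerKrullMap a : {P : Sper L // P.CompatibleRing A} → _) := by
  refine .prodMk (continuous_pi fun i => ?_) (continuous_iff_signHom.2 fun q => ?_)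
  · exact (continuous_signHom_apply (a i)).comp continuous_subtype_val
  · obtain ⟨u, rfl⟩ := A.surjective_unitGroupToResidueFieldUnits q
    simp only [signHom_residueOrder]
    exact (continuous_signHom_apply (u : Lˣ)).comp continuous_subtype_val

include hab

lemma baerKrullMap_injective :
    Function.Injective (baerKrullMap a : {P : Sper L // P.CompatibleRing A} → _) := by
  rintro ⟨P, hP⟩ ⟨Q, hQ⟩ h
  obtain ⟨hsign, hres⟩ := Prod.ext_iff.1 h
  refine Subtype.ext (signHom_injective ?_)
  refine monoidHom_ext_of_basis hab (fun u hu => ?_) (congr_fun hsign)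
  have := congrArg (fun R => R.signHom (A.unitGroupToResidueFieldUnits ⟨u, hu⟩)) hres
  simpa only [baerKrullMap, signHom_residueOrder] using this

lemma baerKrullMap_surjective :
    Function.Surjective (baerKrullMap a : {P : Sper L // P.CompatibleRing A} → _) := by
  rintro ⟨ε, Q⟩
  obtain ⟨χ, hχa, hχ⟩ := exists_monoidHom_extending (mem_unitGroup_of_sq_mem A) hab ε
    (Q.signHom.comp A.unitGroupToResidueFieldUnits)
  obtain ⟨P, hP, rfl, hres⟩ := exists_residueOrder_eq hχ
  exact ⟨⟨P, hP⟩, Prod.ext (funext hχa) hres⟩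

/-- The Baer–Krull theorem, with its topology: `baerKrullMap` as a homeomorphism. -/
def baerKrullHomeomorph : {P : Sper L // P.CompatibleRing A} ≃ₜ
    (ι → ℤˣ) × Sper (IsLocalRing.ResidueField A) where
  toEquiv := .ofBijective _ ⟨baerKrullMap_injective hab, baerKrullMap_surjective hab⟩
  continuous_toFun := continuous_baerKrullMap
  continuous_invFun := by
    set e : {P : Sper L // P.CompatibleRing A} ≃ _ :=
      .ofBijective _ ⟨baerKrullMap_injective hab, baerKrullMap_surjective hab⟩
    have apply_symm (y) : baerKrullMap a (e.symm y) = y := e.apply_symm_apply y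
    refine continuous_induced_rng.2 (continuous_iff_signHom.2 ?_)
    refine continuous_monoidHom_apply_of_basis hab (fun u hu => ?_) fun i => ?_
    · have residue_symm (y) : (e.symm y).1.signHom u =
          y.2.signHom (A.unitGroupToResidueFieldUnits ⟨u, hu⟩) := by
        conv_rhs => rw [← apply_symm y]
        exact (signHom_residueOrder (e.symm y).2 ⟨u, hu⟩).symm
      change Continuous fun y => (e.symm y).1.signHom u
      simp only [residue_symm]
      exact (continuous_signHom_apply _).comp continuous_snd
    · have sign_symm (y) : (e.symm y).1.signHom (a i) = y.1 i :=
        congr_fun (congrArg Prod.fst (apply_symm y)) i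
      change Continuous fun y => (e.symm y).1.signHom (a i)
      simp only [sign_symm]
      exact (continuous_apply i).comp continuous_fst

end Basis

end Sper

end BaerKrull

section ValuationRing

variable {L : Type u} [Field L] {w : AbsoluteValue L ℝ} (hw : IsNonarchimedean w)

lemma mem_valuationRing_iff {a : L} : a ∈ valuationRing w hw ↔ w a ≤ 1 :=
  Iff.rfl

lemma mem_nonunits_valuationRing_iff {a : L} : a ∈ (valuationRing w hw).nonunits ↔ w a < 1 := by
  rw [ValuationSubring.mem_nonunits_iff_or]
  obtain rfl | ha := eq_or_ne a 0
  · simp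
  · rw [mem_valuationRing_iff, or_iff_right ha, not_le, map_inv₀, one_lt_inv₀ (w.pos ha)]

lemma unitGroup_valuationRing :
    (valuationRing w hw).unitGroup = (Units.map (w : L →* ℝ)).ker := by
  ext a
  have apply_le_one_iff := (valuationRing w hw).valuation_le_one_iff (a : L)
  have apply_lt_one_iff := (valuationRing w hw).mem_nonunits_iff (x := (a : L))
  rw [mem_valuationRing_iff] at apply_le_one_iff
  rw [mem_nonunits_valuationRing_iff] at apply_lt_one_iff
  have one_le_iff := not_congr apply_lt_one_iff
  rw [not_lt, not_lt] at one_le_iff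
  rw [ValuationSubring.mem_unitGroup_iff, MonoidHom.mem_ker, Units.ext_iff, le_antisymm_iff,
    apply_le_one_iff, ← one_le_iff, ← le_antisymm_iff]
  rfl

/-- The square classes of the value group of an absolute value, in terms of its valuation ring. -/
def squareClassesEquiv : SquareClasses (Lˣ ⧸ (valuationRing w hw).unitGroup) ≃ valueGroupModTwo w :=
  SquareClasses.congr ((QuotientGroup.quotientMulEquivOfEq (unitGroup_valuationRing hw)).trans
    (QuotientGroup.quotientKerEquivRange (Units.map (w : L →* ℝ))))

lemma Sper.compatible_iff_compatibleRing {P : Sper L} :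
    P.Compatible w ↔ P.CompatibleRing (valuationRing w hw) := by
  refine ⟨fun h m hm => ?_, fun h a b ha hab => ?_⟩
  · rw [mem_nonunits_valuationRing_iff] at hm
    refine (P.nonneg_or_nonneg_neg _).resolve_right fun hneg => hm.not_ge ?_
    have := h 1 (-m) P.nonneg_one (by simpa [sub_eq_add_neg, add_comm] using hneg)
    rwa [map_one, AbsoluteValue.map_neg] at this
  · by_contra! hlt
    have ha0 : a ≠ 0 := w.pos_iff.1 ((w.nonneg b).trans_lt hlt)
    have nonneg_neg : P.Nonneg (-(b - a)) := by
      have := ha.mul (h (-(b / a)) ?_)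
      · convert this using 1
        field_simp
        ring
      · rwa [mem_nonunits_valuationRing_iff, AbsoluteValue.map_neg, map_div₀,
          div_lt_one (w.pos ha0)]
    rw [sub_eq_zero.1 (hab.eq_zero nonneg_neg)] at hlt
    exact lt_irrefl _ hlt

end ValuationRing

section Fiber

namespace Sper

variable {F : Type*} [Field F]

lemma sgn_eq_signHom (P : Sper F) (a : Fˣ) : P.sgn a = ((P.signHom a : ℤ) : ℝ) := by
  rw [sgn, ← Units.val_neg, pos_iff_nonneg a.ne_zero, pos_iff_nonneg (-a).ne_zero,
    ← signHom_eq_one_iff, ← signHom_eq_one_iff, signHom_neg]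
  rcases Int.units_eq_one_or (P.signHom a) with h | h <;> simp [h]

lemma continuous_sgn_mul (w : AbsoluteValue F ℝ) (a : F) :
    Continuous fun P : Sper F => P.sgn a * w a := by
  obtain rfl | ha := eq_or_ne a 0
  · simpa using continuous_const
  lift a to Fˣ using ha.isUnit
  simp only [sgn_eq_signHom]
  exact ((continuous_of_discreteTopology (f := fun e : ℤˣ => ((e : ℤ) : ℝ))).comp
    (continuous_signHom_apply a)).mul_const _

lemma sgn_mul_pos_iff {P : Sper F} {w : AbsoluteValue F ℝ} {a : F} :
    0 < P.sgn a * w a ↔ P.Pos a := by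
  obtain rfl | ha := eq_or_ne a 0
  · simp [not_pos_zero]
  · rw [mul_pos_iff_of_pos_right (w.pos ha), sgn]
    split_ifs with h h' <;> simp [h]

end Sper

variable {K : Type u} [Field K] {X : Scheme.{u}}

lemma exists_evaluation_eq (p : X) (a : X.residueField p) :
    ∃ (U : X.Opens) (hp : p ∈ U) (s : Γ(X, U)), X.evaluation U p hp s = a := by
  obtain ⟨b, rfl⟩ := X.residue_surjective p a
  obtain ⟨U, hp, s, rfl⟩ := X.presheaf.exists_germ_eq b
  exact ⟨U, hp, s, rfl⟩

lemma essFiniteType_germ {U : X.Opens} (hU : IsAffineOpen U) {p : X} (hp : p ∈ U) :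
    (X.presheaf.germ U p hp).hom.EssFiniteType := by
  have := hU.isLocalization_stalk ⟨p, hp⟩
  let := (X.presheaf.germ U p hp).hom.toAlgebra
  exact (RingHom.essFiniteType_algebraMap (R := Γ(X, U)) (S := X.presheaf.stalk p)).2
    (.of_isLocalization _ (hU.primeIdealOf ⟨p, hp⟩).asIdeal.primeCompl)

variable (f : X ⟶ Spec (CommRingCat.of K))

lemma scalarMap_eq_evaluation_comp {U : X.Opens} (hU : IsAffineOpen U) {p : X} (hp : p ∈ U) :
    scalarMap f p =
      (X.evaluation U p hp).hom.comp (Spec.preimage (hU.fromSpec ≫ f)).hom := by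
  rw [scalarMap, ← CommRingCat.hom_comp]
  congr 1
  apply Spec.map_injective
  rw [Spec.map_preimage, Spec.map_comp, Spec.map_preimage, Scheme.fromSpecResidueField,
    ← hU.fromSpecStalk_eq_fromSpecStalk hp, IsAffineOpen.fromSpecStalk, Scheme.evaluation,
    Spec.map_comp]
  simp only [Category.assoc]

lemma essFiniteType_scalarMap [LocallyOfFiniteType f] (p : X) :
    (scalarMap f p).EssFiniteType := by
  obtain ⟨U, hU, hp, -⟩ := exists_isAffineOpen_mem_and_subset (x := p) (U := ⊤) trivial
  have coordinate_ring : (Spec.preimage (hU.fromSpec ≫ f)).hom.FiniteType := by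
    rw [← HasRingHomProperty.Spec_iff (P := @LocallyOfFiniteType), Spec.map_preimage]
    infer_instance
  have residue : (X.residue p).hom.EssFiniteType :=
    (RingHom.FiniteType.of_surjective _ (X.residue_surjective p)).essFiniteType
  rw [scalarMap_eq_evaluation_comp f hU hp]
  exact coordinate_ring.essFiniteType.comp ((essFiniteType_germ hU hp).comp residue)

variable {f} {v : AbsoluteValue K ℝ}

lemma continuous_realAnalytification_mk (x : Analytification v f) :
    Continuous fun P : {P : Sper (X.residueField x.pt) // P.Compatible x.absVal} =>
      (⟨x, P.1, P.2⟩ : RealAnalytification v f) := by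
  refine continuous_generateFrom_iff.2 ?_
  rintro _ (⟨U, rfl⟩ | ⟨U, s, V, hV, rfl⟩)
  · exact isOpen_const (p := x.pt ∈ U)
  · by_cases hx : x.pt ∈ U
    · have continuous_signedValue :=
        (Sper.continuous_sgn_mul x.absVal (X.evaluation U x.pt hx s)).comp
          (continuous_subtype_val (p := fun P => P.Compatible x.absVal))
      convert hV.preimage continuous_signedValue
      ext P
      exact ⟨fun ⟨_, h⟩ => h, fun h => ⟨hx, h⟩⟩
    · convert isOpen_empty
      ext P
      exact ⟨fun ⟨h, _⟩ => hx h, False.elim⟩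

/-- The fiber of the real analytification over `x` consists of the orderings of the residue field
at the support of `x` that are compatible with the absolute value of `x`. -/
def fiberEquiv (x : Analytification v f) :
    {P : Sper (X.residueField x.pt) // P.Compatible x.absVal} ≃
      ((forgetOrder : RealAnalytification v f → Analytification v f) ⁻¹' {x} :
        Set (RealAnalytification v f)) :=
  Equiv.ofBijective (fun P => ⟨⟨x, P.1, P.2⟩, rfl⟩) ⟨fun P Q h => by
    simpa [Subtype.ext_iff] using h, by
    rintro ⟨⟨y, P, hP⟩, rfl⟩
    exact ⟨⟨P, hP⟩, rfl⟩⟩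

/-- The topology of the real analytification restricts on the fiber over `x` to the topology of
the real spectrum. -/
def fiberHomeomorph (x : Analytification v f) :
    {P : Sper (X.residueField x.pt) // P.Compatible x.absVal} ≃ₜ
      ((forgetOrder : RealAnalytification v f → Analytification v f) ⁻¹' {x} :
        Set (RealAnalytification v f)) where
  toEquiv := fiberEquiv x
  continuous_toFun := (continuous_realAnalytification_mk x).subtype_mk _
  continuous_invFun := by
    refine continuous_induced_rng.2 (continuous_generateFrom_iff.2 ?_)
    rintro _ ⟨a, rfl⟩
    obtain ⟨U, hp, s, rfl⟩ := exists_evaluation_eq x.pt a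
    have isOpen_signedValue_pos : IsOpen {y : RealAnalytification v f | ∃ hy : y.pt ∈ U,
        y.signedValue hy s ∈ Set.Ioi 0} :=
      TopologicalSpace.isOpen_generateFrom_of_mem (.inr ⟨U, s, _, isOpen_Ioi, rfl⟩)
    convert isOpen_signedValue_pos.preimage continuous_subtype_val
    ext y
    obtain ⟨P, rfl⟩ := (fiberEquiv x).surjective y
    change Sper.Pos ((fiberEquiv x).symm (fiberEquiv x P)).1 _ ↔ _
    rw [Equiv.symm_apply_apply]
    exact ⟨fun h => ⟨hp, Sper.sgn_mul_pos_iff.2 h⟩, fun ⟨_, h⟩ => Sper.sgn_mul_pos_iff.1 h⟩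

end Fiber

end RealAn

end

open RealAn AlgebraicGeometry in
theorem mainTheorem12_general {K : Type u} [Field K] (hK : ∀ a : K, IsSquare a ∨ IsSquare (-a))
    {v : AbsoluteValue K ℝ} {X : Scheme.{u}} (f : X ⟶ Spec (CommRingCat.of K))
    [LocallyOfFiniteType f] (x : Analytification v f) :
    ∃ (D : Type) (_ : TopologicalSpace D), DiscreteTopology D ∧
      Cardinal.mk D = Cardinal.mk (valueGroupModTwo x.absVal) ∧
      Nonempty
        (((forgetOrder : RealAnalytification v f → Analytification v f) ⁻¹' {x} :
            Set (RealAnalytification v f)) ≃ₜ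
          D × Sper (residueFieldOf x.absVal x.isNonarchimedean)) := by
  let _ : Algebra K (X.residueField x.pt) := (scalarMap f x.pt).toAlgebra
  have : Algebra.EssFiniteType K (X.residueField x.pt) :=
    RingHom.essFiniteType_algebraMap.1 (essFiniteType_scalarMap f x.pt)
  let A := valuationRing x.absVal x.isNonarchimedean
  have : Finite (SquareClasses ((X.residueField x.pt)ˣ ⧸ A.unitGroup)) :=
    finite_squareClasses_quotient_unitGroup hK A
  let b := Module.finBasis (ZMod 2) (SquareClasses ((X.residueField x.pt)ˣ ⧸ A.unitGroup))
  obtain ⟨a, mk_a_eq⟩ := exists_mk_eq_basis b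
  let units_equiv : ℤˣ ≃ ZMod 2 := Fintype.equivOfCardEq rfl
  let signs_equiv := (Equiv.piCongrRight fun _ => units_equiv).trans
    (b.equivFun.toEquiv.symm.trans (squareClassesEquiv x.isNonarchimedean))
  exact ⟨_, inferInstance, inferInstance, signs_equiv.cardinal_eq,
    ⟨(fiberHomeomorph x).symm.trans (.trans (.subtype (.refl _) fun _ =>
      Sper.compatible_iff_compatibleRing x.isNonarchimedean) (Sper.baerKrullHomeomorph mk_a_eq))⟩⟩

theorem mainTheorem12 {K : Type u} [Field K] [LinearOrder K] [IsStrictOrderedRing K]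
    [IsRealClosed K] (v : AbsoluteValue K ℝ) (hv : IsNonarchimedean v)
    (hcompat : ∀ a b : K, 0 ≤ a → a ≤ b → v a ≤ v b)
    {X : AlgebraicGeometry.Scheme.{u}}
    (f : X ⟶ AlgebraicGeometry.Spec (CommRingCat.of K))
    [AlgebraicGeometry.IsIntegral X] [AlgebraicGeometry.IsSeparated f]
    [AlgebraicGeometry.LocallyOfFiniteType f] [AlgebraicGeometry.QuasiCompact f]
    (x : RealAn.Analytification v f) :
    ∃ (D : Type) (_ : TopologicalSpace D), DiscreteTopology D ∧
      Cardinal.mk D = Cardinal.mk (RealAn.valueGroupModTwo x.absVal) ∧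
      Nonempty
        (((RealAn.forgetOrder : RealAn.RealAnalytification v f → RealAn.Analytification v f) ⁻¹'
            {x} : Set (RealAn.RealAnalytification v f)) ≃ₜ
          D × RealAn.Sper (RealAn.residueFieldOf x.absVal x.isNonarchimedean)) :=
  mainTheorem12_general IsRealClosed.isSquare_or_isSquare_neg f x
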